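/- For $0<p<\infty$ let $PW^p$ be the Paley–Wiener space of all entire functions $f$ of exponential type at most $\pi$ (that is, for every $\varepsilon>0$ there is a constant $A$ such that $|f(z)|\le A e^{(\pi+\varepsilon)|z|}$ for all $z\in\mathbb{C}$) whose restriction to $\mathbb{R}$ belongs to $L^p(\mathbb{R})$, and put $\|f\|_p^p=\int_{-\infty}^{\infty}|f(x)|^p\,dx$. Let $\mathscr{C}_p$ denote the smallest positive constant $C$ such that $$|f(0)|^p\le C\,\|f\|_p^p\qquad\text{for every } f\in PW^p.$$ **Theorem.** For $p=4$ such a smallest positive constant exists, and $$\mathscr{C}_4\le 2-\frac1{12}.$$ -/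

import Mathlib

open MeasureTheory

/-- The entire function `f` has exponential type at most `τ`:
for every `ε > 0` one has `|f z| = O(exp ((τ + ε) |z|))` on the complex plane. -/
def HasExpTypeAtMost (f : ℂ → ℂ) (τ : ℝ) : Prop :=
  ∀ ε : ℝ, 0 < ε → ∃ A : ℝ, ∀ z : ℂ, ‖f z‖ ≤ A * Real.exp ((τ + ε) * ‖z‖)

/-- The Paley--Wiener space `PW^p`, for `0 < p < ∞`: the entire functions of exponential type
at most `π` whose restriction to the real line belongs to `L^p(ℝ)`. -/
def PaleyWiener (p : ℝ) : Set (ℂ → ℂ) :=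
  {f | Differentiable ℂ f ∧ HasExpTypeAtMost f Real.pi ∧
    MemLp (fun x : ℝ => f (x : ℂ)) (ENNReal.ofReal p) volume}

/-- The positive constants `C` for which `|f(0)|^p ≤ C ‖f‖_p^p` holds for every `f` in `PW^p`. -/
def pointEvalBounds (p : ℝ) : Set ℝ :=
  {C | 0 < C ∧ ∀ f ∈ PaleyWiener p, ‖f 0‖ ^ p ≤ C * ∫ x : ℝ, ‖f (x : ℂ)‖ ^ p}

/-- The constant `𝒞_p`: the infimum of the admissible constants (it is meaningful as the smallest
admissible constant when `IsLeast (pointEvalBounds p) (pointEvalConst p)` holds). -/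
noncomputable def pointEvalConst (p : ℝ) : ℝ :=
  sInf (pointEvalBounds p)

/-! For `f` in `PW^4`, the function `g z = f z * star (f (star z))` is entire of type `2π`, lies in
`L²(ℝ)`, and equals `|f|² ≥ 0` on the real line. Its Fourier transform lives on `[-1, 1]`, so `g 0 +
c * g a` is the integral of `1 + c e^{2πiaξ}` against it. Cauchy–Schwarz and Plancherel
(`norm_add_mul_sq_le`) bound its square by `‖g‖₂²` times `2(1 + c²) + 4c sin(2πa)/(2πa)`. Taking `c
= 0` gives the constant 2. If `c > 0`, positivity still gives `g 0 ≤ g 0 + c * g a`, and a point `a`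
where the sine is negative lowers the constant.

Spectral support (`fourier_eq_zero`) comes from Phragmén–Lindelöf and a contour shift, which need
quadratic decay on the line. General `L²` functions are reduced to that case by a linear growth
bound and multiplication by `s(εz)³`, with `ε → 0`. -/

namespace HasExpTypeAtMost

/-! ### Functions of exponential type and their growth off the real line -/

variable {f g : ℂ → ℂ} {σ τ : ℝ}

theorem mono (hf : HasExpTypeAtMost f σ) (h : σ ≤ τ) : HasExpTypeAtMost f τ := by
  intro ε hε
  obtain ⟨A, hA⟩ := hf ε hε
  have hA0 : 0 ≤ A := by simpa using (norm_nonneg _).trans (hA 0)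
  exact ⟨A, fun z => (hA z).trans (by gcongr)⟩

theorem mul (hf : HasExpTypeAtMost f σ) (hg : HasExpTypeAtMost g τ) :
    HasExpTypeAtMost (fun z => f z * g z) (σ + τ) := by
  intro ε hε
  obtain ⟨A, hA⟩ := hf (ε / 2) (by positivity)
  obtain ⟨B, hB⟩ := hg (ε / 2) (by positivity)
  have hA0 : 0 ≤ A := by simpa using (norm_nonneg _).trans (hA 0)
  refine ⟨A * B, fun z => ?_⟩
  rw [norm_mul]
  refine (mul_le_mul (hA z) (hB z) (norm_nonneg _) (by positivity)).trans_eq ?_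
  rw [mul_mul_mul_comm, ← Real.exp_add]
  congr 2
  ring

theorem comp_mul (hf : HasExpTypeAtMost f σ) (c : ℂ) :
    HasExpTypeAtMost (fun z => f (c * z)) (‖c‖ * σ) := by
  intro ε hε
  obtain ⟨A, hA⟩ := hf (ε / (‖c‖ + 1)) (by positivity)
  have hA0 : 0 ≤ A := by simpa using (norm_nonneg _).trans (hA 0)
  refine ⟨A, fun z => (hA _).trans ?_⟩
  rw [norm_mul, ← mul_assoc]
  have h : ε / (‖c‖ + 1) * ‖c‖ ≤ ε := by
    rw [div_mul_eq_mul_div, div_le_iff₀ (by positivity)]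
    nlinarith [norm_nonneg c]
  gcongr
  linarith

theorem star_comp_star (hf : HasExpTypeAtMost f σ) :
    HasExpTypeAtMost (fun z => star (f (star z))) σ := by
  intro ε hε
  obtain ⟨A, hA⟩ := hf ε hε
  exact ⟨A, fun z => by simpa using hA (star z)⟩

theorem add_const (c : ℂ) : HasExpTypeAtMost (fun z => z + c) 0 := by
  intro ε hε
  refine ⟨ε⁻¹ + ‖c‖, fun z => ?_⟩
  have h1 : ε * ‖z‖ ≤ Real.exp (ε * ‖z‖) := by linarith [Real.add_one_le_exp (ε * ‖z‖)]
  have h2 : 1 ≤ Real.exp (ε * ‖z‖) := Real.one_le_exp (by positivity)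
  rw [zero_add, add_mul]
  refine (norm_add_le _ _).trans (add_le_add ?_ (le_mul_of_one_le_right (norm_nonneg c) h2))
  rwa [inv_mul_eq_div, le_div_iff₀' hε]

theorem cexp : HasExpTypeAtMost Complex.exp 1 := by
  intro ε hε
  refine ⟨1, fun z => ?_⟩
  rw [Complex.norm_exp, one_mul, Real.exp_le_exp]
  nlinarith [Complex.re_le_norm z, norm_nonneg z]

/-- Division by `z` only helps where `|z| ≥ 1`; on the unit disc the removable singularity leaves a
continuous function on a compact set. -/
theorem dslope (hf : HasExpTypeAtMost f σ) (hd : Differentiable ℂ f) (hσ : 0 ≤ σ) :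
    HasExpTypeAtMost (dslope f 0) σ := by
  intro ε hε
  obtain ⟨A, hA⟩ := hf ε hε
  have hcont : Continuous (_root_.dslope f 0) := by
    have := (Complex.differentiableOn_dslope (f := f) (c := 0) (s := Set.univ)
      Filter.univ_mem).2 hd.differentiableOn
    exact (differentiableOn_univ.1 this).continuous
  obtain ⟨B, hB⟩ := (isCompact_closedBall (0 : ℂ) 1).exists_bound_of_continuousOn
    hcont.continuousOn
  have hA0 : 0 ≤ A := by simpa using (norm_nonneg _).trans (hA 0)
  have hB0 : 0 ≤ B := (norm_nonneg _).trans (hB 0 (by simp))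
  refine ⟨A + ‖f 0‖ + B, fun z => ?_⟩
  have h1 : 1 ≤ Real.exp ((σ + ε) * ‖z‖) := Real.one_le_exp (by positivity)
  rcases le_total ‖z‖ 1 with hz | hz
  · refine (hB z (by simpa using hz)).trans ?_
    nlinarith [norm_nonneg (f 0)]
  · have hz0 : z ≠ 0 := by
      rintro rfl
      norm_num at hz
    rw [dslope_of_ne _ hz0, slope_def_field, sub_zero, norm_div]
    refine (div_le_self (norm_nonneg _) hz).trans ((norm_sub_le _ _).trans ?_)
    have := hA z
    nlinarith [norm_nonneg (f 0)]

theorem of_hasDerivAt (hg : HasExpTypeAtMost g σ) (hσ : 0 ≤ σ)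
    (hd : ∀ z, HasDerivAt f (g z) z) : HasExpTypeAtMost f σ := by
  intro ε hε
  obtain ⟨A, hA⟩ := hg (ε / 2) (by positivity)
  have hA0 : 0 ≤ A := by simpa using (norm_nonneg _).trans (hA 0)
  refine ⟨‖f 0‖ + A * (2 / ε), fun z => ?_⟩
  have key : ‖f z - f 0‖ ≤ A * Real.exp ((σ + ε / 2) * ‖z‖) * ‖z - 0‖ := by
    refine (convex_closedBall (0 : ℂ) ‖z‖).norm_image_sub_le_of_norm_hasDerivWithin_le
      (f' := g) (fun w _ => (hd w).hasDerivWithinAt) (fun w hw => (hA w).trans ?_)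
      (by simp) (by simp)
    have hw' : ‖w‖ ≤ ‖z‖ := by simpa using hw
    gcongr
  have h1 : ‖z‖ ≤ 2 / ε * Real.exp (ε / 2 * ‖z‖) := by
    rw [div_mul_eq_mul_div, le_div_iff₀ hε]
    nlinarith [Real.add_one_le_exp (ε / 2 * ‖z‖)]
  have h2 : 1 ≤ Real.exp ((σ + ε) * ‖z‖) := Real.one_le_exp (by positivity)
  calc ‖f z‖ = ‖f 0 + (f z - f 0)‖ := by congr 1; ring
    _ ≤ ‖f 0‖ + A * Real.exp ((σ + ε / 2) * ‖z‖) * ‖z - 0‖ :=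
      (norm_add_le _ _).trans (by gcongr)
    _ ≤ ‖f 0‖ * Real.exp ((σ + ε) * ‖z‖) +
        A * Real.exp ((σ + ε / 2) * ‖z‖) * (2 / ε * Real.exp (ε / 2 * ‖z‖)) := by
      rw [sub_zero]
      gcongr
      exact le_mul_of_one_le_right (norm_nonneg _) h2
    _ = _ := by
      rw [show (σ + ε) * ‖z‖ = (σ + ε / 2) * ‖z‖ + ε / 2 * ‖z‖ by ring, Real.exp_add]
      ring

/-- A Phragmén–Lindelöf bound: an entire function of exponential type bounded by `M` on the real
line grows at most like `M exp (σ' Im z)` in the upper half-plane. -/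
theorem norm_le_exp_im (hf : HasExpTypeAtMost f σ) (hd : Differentiable ℂ f) (hσ : σ < τ)
    {M : ℝ} (hM : ∀ x : ℝ, ‖f x‖ ≤ M) {z : ℂ} (hz : 0 ≤ z.im) :
    ‖f z‖ ≤ M * Real.exp (τ * z.im) := by
  -- The slack `τ - σ` turns the type bound into `A exp(τ|z|)`, so after rotation to the right
  -- half-plane the factor `exp(-τw)` gives boundedness on the positive axis.
  obtain ⟨A, hA⟩ := hf (τ - σ) (by linarith)
  have hA0 : 0 ≤ A := by simpa using (norm_nonneg _).trans (hA 0)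
  have hnorm (w : ℂ) : ‖f (Complex.I * w) * Complex.exp (-(τ * w))‖ =
      ‖f (Complex.I * w)‖ * Real.exp (-(τ * w.re)) := by
    rw [norm_mul, Complex.norm_exp]
    simp
  have hdiff : Differentiable ℂ fun w => f (Complex.I * w) * Complex.exp (-(τ * w)) := by
    fun_prop
  have hPL := PhragmenLindelof.right_half_plane_of_bounded_on_real
    (f := fun w => f (Complex.I * w) * Complex.exp (-(τ * w))) (C := M)
    (z := -Complex.I * z) hdiff.diffContOnCl
    ⟨1, by norm_num, τ + |τ|, ?_⟩ ?_ ?_ (by simpa using hz)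
  · rw [hnorm, show Complex.I * (-Complex.I * z) = z by
      rw [← mul_assoc]; simp, show (-Complex.I * z).re = z.im by simp, Real.exp_neg,
      ← div_eq_mul_inv, div_le_iff₀ (Real.exp_pos _)] at hPL
    exact hPL
  · refine Asymptotics.IsBigO.of_bound A (Filter.Eventually.of_forall fun w => ?_)
    rw [hnorm, Real.rpow_one, Real.norm_eq_abs, Real.abs_exp, add_mul, Real.exp_add, ← mul_assoc]
    have h := hA (Complex.I * w)
    rw [norm_mul, Complex.norm_I, one_mul, add_sub_cancel] at h
    gcongr
    calc -(τ * w.re) ≤ |τ * w.re| := neg_le_abs _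
      _ = |τ| * |w.re| := abs_mul _ _
      _ ≤ |τ| * ‖w‖ := by gcongr; exact Complex.abs_re_le_norm w
  · refine Filter.isBoundedUnder_of_eventually_le (a := A) ?_
    filter_upwards [Filter.eventually_ge_atTop 0] with x hx
    rw [hnorm]
    have h := hA (Complex.I * x)
    rw [norm_mul, Complex.norm_I, one_mul, add_sub_cancel, Complex.norm_real, Real.norm_eq_abs,
      abs_of_nonneg hx] at h
    rw [Complex.ofReal_re, Real.exp_neg, ← div_eq_mul_inv, div_le_iff₀ (Real.exp_pos _)]
    exact h
  · intro x
    have h : Complex.I * (x * Complex.I) = ((-x : ℝ) : ℂ) := by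
      push_cast
      linear_combination (x : ℂ) * Complex.I_mul_I
    rw [hnorm, h]
    simpa using hM (-x)

theorem norm_le_exp_abs_im (hf : HasExpTypeAtMost f σ) (hd : Differentiable ℂ f) (hσ : σ < τ)
    {M : ℝ} (hM : ∀ x : ℝ, ‖f x‖ ≤ M) (z : ℂ) : ‖f z‖ ≤ M * Real.exp (τ * |z.im|) := by
  rcases le_total 0 z.im with hz | hz
  · rw [abs_of_nonneg hz]
    exact hf.norm_le_exp_im hd hσ hM hz
  · have hf' : HasExpTypeAtMost (fun z => f (-1 * z)) σ := by simpa using hf.comp_mul (-1)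
    have := hf'.norm_le_exp_im (z := -z) (M := M) (by fun_prop) hσ
      (fun x => by simpa using hM (-x)) (by simpa using hz)
    simpa [abs_of_nonpos hz] using this

end HasExpTypeAtMost

/-! ### Contour shift, support of the Fourier transform, Plancherel -/

open Complex FourierTransform Filter Topology in
/-- An entire function which is `O(|z + i|⁻²)` in the closed upper half-plane has vanishing
integral over the real line. -/
theorem integral_ofReal_eq_zero_of_decay {f : ℂ → ℂ} (hd : Differentiable ℂ f) {C : ℝ}
    (hC : ∀ z : ℂ, 0 ≤ z.im → ‖f z‖ * ‖z + I‖ ^ 2 ≤ C) : ∫ x : ℝ, f x = 0 := by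
  have hnorm (z : ℂ) : ‖z + I‖ ^ 2 = z.re ^ 2 + (z.im + 1) ^ 2 := by
    rw [Complex.sq_norm, Complex.normSq_apply]
    simp
    ring
  have hC0 : 0 ≤ C := le_trans (by positivity) (hC 0 (by simp))
  have hfar {R : ℝ} (hR : 0 < R) (z : ℂ) (hz : 0 ≤ z.im) (h : R ^ 2 ≤ ‖z + I‖ ^ 2) :
      ‖f z‖ ≤ C / R ^ 2 := by
    rw [le_div_iff₀ (by positivity)]
    exact (mul_le_mul_of_nonneg_left h (norm_nonneg _)).trans (hC z hz)
  have hint : Integrable fun x : ℝ => f x := by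
    refine (integrable_inv_one_add_sq.const_mul C).mono'
      (hd.continuous.comp continuous_ofReal).aestronglyMeasurable (.of_forall fun x => ?_)
    rw [← div_eq_mul_inv, le_div_iff₀ (by positivity)]
    have := hC x (by simp)
    rw [hnorm] at this
    simpa [add_comm] using this
  have hlim := intervalIntegral_tendsto_integral hint tendsto_neg_atTop_atBot tendsto_id
  refine tendsto_nhds_unique hlim (squeeze_zero_norm' (a := fun R => 4 * C / R) ?_
    (tendsto_const_nhds.div_atTop tendsto_id))
  filter_upwards [eventually_gt_atTop 0] with R hR
  have hrect := integral_boundary_rect_eq_zero_of_differentiableOn f (-R : ℂ) (R + R * I)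
    hd.differentiableOn
  simp only [neg_re, ofReal_re, neg_im, ofReal_im, neg_zero, add_re, mul_re, I_re, mul_zero, I_im,
    mul_one, add_im, mul_im, zero_add, add_zero, ofReal_zero, zero_mul,
    sub_self, ofReal_neg] at hrect
  have htop : ‖∫ x : ℝ in -R..R, f (x + R * I)‖ ≤ C / R ^ 2 * |R - -R| := by
    -- The top and the two vertical sides have total length `4R` and stay at distance at least `R`
    -- from `-i`, so they contribute at most `4C/R`.
    refine intervalIntegral.norm_integral_le_of_norm_le_const fun x _ =>
      hfar hR _ (by simpa using hR.le) ?_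
    rw [hnorm]
    simp
    nlinarith [sq_nonneg x]
  have hright : ‖∫ y : ℝ in 0..R, f (R + y * I)‖ ≤ C / R ^ 2 * |R - 0| := by
    refine intervalIntegral.norm_integral_le_of_norm_le_const fun y hy => hfar hR _ ?_ ?_
    · rw [Set.uIoc_of_le hR.le] at hy
      simpa using hy.1.le
    · rw [hnorm]
      simp
      positivity
  have hleft : ‖∫ y : ℝ in 0..R, f (-R + y * I)‖ ≤ C / R ^ 2 * |R - 0| := by
    refine intervalIntegral.norm_integral_le_of_norm_le_const fun y hy => hfar hR _ ?_ ?_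
    · rw [Set.uIoc_of_le hR.le] at hy
      simpa using hy.1.le
    · rw [hnorm]
      simp
      positivity
  have hbot : ∫ x : ℝ in -R..R, f x = (∫ x : ℝ in -R..R, f (x + R * I)) -
      I * (∫ y : ℝ in 0..R, f (R + y * I)) + I * ∫ y : ℝ in 0..R, f (-R + y * I) := by
    simp only [smul_eq_mul] at hrect
    linear_combination hrect
  change ‖∫ x : ℝ in -R..R, f x‖ ≤ 4 * C / R
  rw [hbot]
  refine (norm_add_le _ _).trans ((add_le_add_left (norm_sub_le _ _) _).trans ?_)
  rw [norm_mul, norm_mul, norm_I, one_mul, one_mul]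
  refine (add_le_add (add_le_add htop hright) hleft).trans_eq ?_
  rw [sub_neg_eq_add, sub_zero, abs_of_pos hR, abs_of_pos (by linarith)]
  field_simp
  ring

namespace HasExpTypeAtMost

open Complex FourierTransform Filter Topology

variable {f : ℂ → ℂ} {σ C : ℝ}

/-- Since `|x + i|² = 1 + x²`, Phragmén–Lindelöf applies to `f(z)(z + i)²`; its growth `exp(-2πξ Im
z)` is exactly cancelled by `|exp(-2πiξz)|`. -/
theorem fourier_eq_zero_of_neg (hf : HasExpTypeAtMost f σ) (hd : Differentiable ℂ f)
    (hC : ∀ x : ℝ, ‖f x‖ * (1 + x ^ 2) ≤ C) {ξ : ℝ} (hξ : σ < -(2 * Real.pi * ξ)) :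
    𝓕 (fun x : ℝ => f x) ξ = 0 := by
  have htype : HasExpTypeAtMost (fun z => f z * ((z + I) * (z + I))) σ := by
    simpa using hf.mul ((add_const I).mul (add_const I))
  rw [Real.fourier_real_eq_integral_exp_smul]
  have := integral_ofReal_eq_zero_of_decay
    (f := fun z => cexp (((-2 * Real.pi * ξ : ℝ) : ℂ) * z * I) * f z) (C := C) (by fun_prop) ?_
  · refine Eq.trans (integral_congr_ae (.of_forall fun x => ?_)) this
    simp only [smul_eq_mul]
    congr 3
    push_cast
    ring
  · intro z hz
    have h := htype.norm_le_exp_im (z := z) (M := C) (by fun_prop) hξ (fun x => ?_) hz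
    · rw [norm_mul, norm_exp]
      rw [norm_mul, norm_mul, ← sq] at h
      have hre : (((-2 * Real.pi * ξ : ℝ) : ℂ) * z * I).re = -(-(2 * Real.pi * ξ) * z.im) := by
        simp only [mul_re, ofReal_re, ofReal_im, I_re, I_im, mul_im]
        ring
      rw [hre, Real.exp_neg, mul_assoc, inv_mul_le_iff₀ (Real.exp_pos _), mul_comm _ C]
      exact h
    · rw [norm_mul, norm_mul, ← sq, Complex.sq_norm, Complex.normSq_apply]
      convert hC x using 2
      simp
      ring

/-- An easy case of the Paley–Wiener theorem. -/
theorem fourier_eq_zero (hf : HasExpTypeAtMost f σ) (hd : Differentiable ℂ f)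
    (hC : ∀ x : ℝ, ‖f x‖ * (1 + x ^ 2) ≤ C) {ξ : ℝ} (hξ : σ < 2 * Real.pi * |ξ|) :
    𝓕 (fun x : ℝ => f x) ξ = 0 := by
  rcases le_total ξ 0 with h | h
  · rw [abs_of_nonpos h] at hξ
    exact hf.fourier_eq_zero_of_neg hd hC (by linarith)
  · rw [abs_of_nonneg h] at hξ
    have hf' : HasExpTypeAtMost (fun z => f (-1 * z)) σ := by simpa using hf.comp_mul (-1)
    have := hf'.fourier_eq_zero_of_neg (ξ := -ξ) (C := C) (by fun_prop)
      (fun x => by simpa using hC (-x)) (by linarith)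
    rw [Real.fourier_real_eq_integral_exp_smul] at this ⊢
    rw [← this, ← integral_neg_eq_self]
    simp

/-- Plancherel's theorem for continuous functions with integrable Fourier transform. -/
theorem _root_.integral_norm_sq_fourier_eq {u : ℝ → ℂ} (hu : Continuous u) (hi : Integrable u)
    (hi' : Integrable (𝓕 u)) : ∫ ξ, ‖𝓕 u ξ‖ ^ 2 = ∫ x, ‖u x‖ ^ 2 := by
  have h := VectorFourier.integral_sesq_fourierIntegral_eq_neg_flip (μ := volume) (ν := volume)
    (innerSL ℂ (E := ℂ)) Real.continuous_fourierChar (L := innerₗ ℝ) continuous_inner hi hi'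
  -- Flipping the sign of the pairing turns the second transform into the inverse one, which
  -- recovers `u`.
  have h2 : VectorFourier.fourierIntegral Real.fourierChar volume (-(innerₗ ℝ).flip) (𝓕 u) = u := by
    conv_rhs => rw [← hu.fourierInv_fourier_eq hi hi']
    ext x
    simp [VectorFourier.fourierIntegral, Real.fourierInv_eq]
  rw [h2] at h
  change ∫ ξ, inner ℂ (𝓕 u ξ) (𝓕 u ξ) = ∫ x, inner ℂ (u x) (u x) at h
  simp only [inner_self_eq_norm_sq_to_K] at h
  have h3 : ((∫ ξ, ‖𝓕 u ξ‖ ^ 2 : ℝ) : ℂ) = ((∫ x, ‖u x‖ ^ 2 : ℝ) : ℂ) := by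
    rw [← integral_complex_ofReal, ← integral_complex_ofReal]
    simpa using h
  exact_mod_cast h3

end HasExpTypeAtMost

/-- The Cauchy–Schwarz inequality for Bochner integrals of square-integrable scalar functions. -/
theorem norm_integral_mul_sq_le {α : Type*} {m : MeasurableSpace α} {μ : Measure α} {u v : α → ℂ}
    (hu : MemLp u 2 μ) (hv : MemLp v 2 μ) :
    ‖∫ x, u x * v x ∂μ‖ ^ 2 ≤ (∫ x, ‖u x‖ ^ 2 ∂μ) * ∫ x, ‖v x‖ ^ 2 ∂μ := by
  have h := integral_mul_le_Lp_mul_Lq_of_nonneg (μ := μ) Real.HolderConjugate.two_two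
    (f := fun x => ‖u x‖) (g := fun x => ‖v x‖) (.of_forall fun _ => norm_nonneg _)
    (.of_forall fun _ => norm_nonneg _) (by simpa using hu.norm) (by simpa using hv.norm)
  have h' : ‖∫ x, u x * v x ∂μ‖ ≤ ∫ x, ‖u x‖ * ‖v x‖ ∂μ := by
    simpa only [norm_mul] using norm_integral_le_integral_norm (μ := μ) fun x => u x * v x
  simp only [Real.rpow_two, ← Real.sqrt_eq_rpow] at h
  have hU : 0 ≤ ∫ x, ‖u x‖ ^ 2 ∂μ := integral_nonneg fun _ => by positivity
  have hV : 0 ≤ ∫ x, ‖v x‖ ^ 2 ∂μ := integral_nonneg fun _ => by positivity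
  calc ‖∫ x, u x * v x ∂μ‖ ^ 2
      ≤ (√(∫ x, ‖u x‖ ^ 2 ∂μ) * √(∫ x, ‖v x‖ ^ 2 ∂μ)) ^ 2 := by
        gcongr
        exact h'.trans h
    _ = _ := by rw [mul_pow, Real.sq_sqrt hU, Real.sq_sqrt hV]

/-! ### The two-point inequality in `L²` -/

namespace HasExpTypeAtMost

open Complex FourierTransform Filter Topology

variable {f : ℂ → ℂ} {σ C : ℝ}

theorem norm_add_mul_sq_le_of_decay (hf : HasExpTypeAtMost f σ) (hd : Differentiable ℂ f)
    (hC : ∀ x : ℝ, ‖f x‖ * (1 + x ^ 2) ≤ C) {T : ℝ} (hT : 0 ≤ T) (hσ : σ ≤ 2 * Real.pi * T)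
    (a c : ℝ) :
    ‖f 0 + c * f a‖ ^ 2 ≤ (∫ ξ in -T..T, (1 + c ^ 2 + 2 * c * Real.cos (2 * Real.pi * a * ξ))) *
      ∫ x : ℝ, ‖f x‖ ^ 2 := by
  set u : ℝ → ℂ := fun x => f x with hu
  have hcont : Continuous u := hd.continuous.comp continuous_ofReal
  have hint : Integrable u := by
    refine (integrable_inv_one_add_sq.const_mul C).mono' hcont.aestronglyMeasurable
      (.of_forall fun x => ?_)
    rw [← div_eq_mul_inv, le_div_iff₀ (by positivity)]
    exact hC x
  have hFcont : Continuous (𝓕 u) := VectorFourier.fourierIntegral_continuous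
    Real.continuous_fourierChar continuous_inner hint
  have hF0 : ∀ ξ ∉ Set.Icc (-T) T, 𝓕 u ξ = 0 := fun ξ hξ => by
    refine hf.fourier_eq_zero hd hC (hσ.trans_lt ?_)
    have : T < |ξ| := by
      rw [← not_le, abs_le]
      exact hξ
    gcongr
  have hFcs : HasCompactSupport (𝓕 u) := HasCompactSupport.intro isCompact_Icc hF0
  have hFint : Integrable (𝓕 u) := hFcont.integrable_of_hasCompactSupport hFcs
  have hinv (v : ℝ) : u v = ∫ ξ, cexp ((2 * Real.pi * ξ * v : ℝ) * I) * 𝓕 u ξ := by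
    conv_lhs => rw [← hcont.fourierInv_fourier_eq hint hFint]
    rw [Real.fourierInv_eq']
    simp [mul_assoc, mul_comm v]
  have hexpint (v : ℝ) : Integrable fun ξ => cexp ((2 * Real.pi * ξ * v : ℝ) * I) * 𝓕 u ξ := by
    refine hFint.bdd_mul (c := 1) (Continuous.aestronglyMeasurable (by fun_prop))
      (.of_forall fun ξ => ?_)
    rw [norm_exp_ofReal_mul_I]
  set w : ℝ → ℂ := fun ξ => 1 + c * cexp ((2 * Real.pi * ξ * a : ℝ) * I) with hw
  have hwcont : Continuous w := by fun_prop
  have hsum : f 0 + c * f a = ∫ ξ, w ξ * 𝓕 u ξ := by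
    have h0 : f 0 = u 0 := by simp [hu]
    have ha : f a = u a := rfl
    rw [h0, ha, hinv 0, hinv a, ← integral_const_mul, ← integral_add (hexpint 0)
      ((hexpint a).const_mul _)]
    refine integral_congr_ae (.of_forall fun ξ => ?_)
    simp only [hw, mul_zero, ofReal_zero, zero_mul, Complex.exp_zero]
    ring
  have hres : ∫ ξ, w ξ * 𝓕 u ξ = ∫ ξ in Set.Icc (-T) T, w ξ * 𝓕 u ξ := by
    refine (setIntegral_eq_integral_of_forall_compl_eq_zero fun ξ hξ => ?_).symm
    rw [hF0 ξ hξ, mul_zero]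
  have hwnorm (ξ : ℝ) : ‖w ξ‖ ^ 2 = 1 + c ^ 2 + 2 * c * Real.cos (2 * Real.pi * a * ξ) := by
    rw [hw, Complex.sq_norm, Complex.normSq_apply]
    simp only [add_re, one_re, re_ofReal_mul, exp_ofReal_mul_I_re, add_im, one_im, im_ofReal_mul,
      exp_ofReal_mul_I_im]
    rw [mul_right_comm _ ξ a]
    linear_combination c ^ 2 * Real.sin_sq_add_cos_sq (2 * Real.pi * a * ξ)
  have hFsq : ∫ ξ in Set.Icc (-T) T, ‖𝓕 u ξ‖ ^ 2 = ∫ x : ℝ, ‖f x‖ ^ 2 := by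
    rw [← integral_norm_sq_fourier_eq hcont hint hFint]
    refine setIntegral_eq_integral_of_forall_compl_eq_zero fun ξ hξ => ?_
    rw [hF0 ξ hξ, norm_zero, zero_pow two_ne_zero]
  have hmem {g : ℝ → ℂ} (hg : Continuous g) : MemLp g 2 (volume.restrict (Set.Icc (-T) T)) := by
    obtain ⟨B, hB⟩ := (isCompact_Icc (a := -T) (b := T)).exists_bound_of_continuousOn hg.continuousOn
    exact MemLp.of_bound hg.aestronglyMeasurable B
      ((ae_restrict_iff' measurableSet_Icc).2 (.of_forall hB))
  rw [hsum, hres, ← hFsq, intervalIntegral.integral_of_le (by linarith),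
    ← integral_Icc_eq_integral_Ioc]
  simp only [← hwnorm]
  exact norm_integral_mul_sq_le (hmem hwcont) (hmem hFcont)

/-- A function of exponential type in `L²(ℝ)` grows at most linearly on the real line. -/
theorem exists_norm_le_of_memLp (hf : HasExpTypeAtMost f σ) (hd : Differentiable ℂ f)
    (hσ : 0 ≤ σ) (hL : MemLp (fun x : ℝ => f x) 2) :
    ∃ C, ∀ x : ℝ, ‖f x‖ ≤ C * (1 + |x|) := by
  obtain ⟨P, hP⟩ := hd.isExactOn_univ
  replace hP : ∀ z, HasDerivAt P (f z) z := fun z => hP z trivial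
  have hPd : Differentiable ℂ P := fun z => (hP z).differentiableAt
  -- With `P` a primitive of `f`, the quotient `Q = (P - P 0)/z` is bounded on the line, and `f = Q
  -- + zQ'` reduces linear growth to a bound on `Q'`.
  set Q := _root_.dslope P 0 with hQ
  have hQd : Differentiable ℂ Q := differentiableOn_univ.1
    ((Complex.differentiableOn_dslope Filter.univ_mem).2 hPd.differentiableOn)
  have hQtype : HasExpTypeAtMost Q σ := (hf.of_hasDerivAt hσ hP).dslope hPd hσ
  have hPQ (z : ℂ) : P z = P 0 + z * Q z := by
    have := sub_smul_dslope P 0 z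
    rw [sub_zero, smul_eq_mul] at this
    rw [hQ, this]
    ring
  have hfQ (z : ℂ) : f z = Q z + z * deriv Q z := by
    have h1 : HasDerivAt P (1 * Q z + z * deriv Q z) z := by
      have h2 := ((hasDerivAt_id z).mul (hQd z).hasDerivAt).const_add (P 0)
      refine h2.congr_of_eventuallyEq (.of_forall fun w => ?_)
      simpa using hPQ w
    rw [(hP z).unique h1, one_mul]
  have hfcont : Continuous fun x : ℝ => f x := hd.continuous.comp continuous_ofReal
  -- the increments of the primitive are controlled by Cauchy–Schwarz
  have hPx (x : ℝ) : ‖P x - P 0‖ ^ 2 ≤ |x| * ∫ t : ℝ, ‖f t‖ ^ 2 := by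
    have hFTC : P x - P 0 = ∫ t in (0 : ℝ)..x, f t := by
      rw [intervalIntegral.integral_eq_sub_of_hasDerivAt (f := fun t : ℝ => P t)
        (fun t _ => (hP t).comp_ofReal) (hfcont.intervalIntegrable _ _), ofReal_zero]
    have : IsFiniteMeasure (volume.restrict (Set.uIoc 0 x)) := ⟨by simp⟩
    have hone : MemLp (fun _ : ℝ => (1 : ℂ)) 2 (volume.restrict (Set.uIoc 0 x)) :=
      memLp_const 1
    have h := norm_integral_mul_sq_le hone (hL.restrict (Set.uIoc 0 x))
    rw [hFTC, intervalIntegral.norm_intervalIntegral_eq]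
    simp only [one_mul] at h
    refine h.trans ?_
    have hle : ∫ t in Set.uIoc 0 x, ‖f t‖ ^ 2 ≤ ∫ t : ℝ, ‖f t‖ ^ 2 :=
      setIntegral_le_integral (hL.integrable_norm_pow two_ne_zero) (.of_forall fun t => by positivity)
    have hvol : ∫ t in Set.uIoc 0 x, ‖(1 : ℂ)‖ ^ 2 = |x| := by
      simp [measureReal_def, Real.volume_uIoc]
    rw [hvol]
    gcongr
  obtain ⟨B, hB⟩ := (isCompact_Icc (a := (-1 : ℝ)) (b := 1)).exists_bound_of_continuousOn
    (f := fun x : ℝ => Q x) (hQd.continuous.comp continuous_ofReal).continuousOn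
  set J := ∫ t : ℝ, ‖f t‖ ^ 2 with hJ
  have hJ0 : 0 ≤ J := integral_nonneg fun t => by positivity
  have hQreal (x : ℝ) : ‖Q x‖ ≤ max B √J := by
    rcases le_or_gt |x| 1 with hx | hx
    · exact (hB x (abs_le.1 hx)).trans (le_max_left _ _)
    · refine le_trans ?_ (le_max_right _ _)
      refine Real.le_sqrt_of_sq_le ?_
      have h := hPx x
      rw [hPQ x, add_sub_cancel_left, norm_mul, norm_real, Real.norm_eq_abs, mul_pow] at h
      have h3 : |x| * ‖Q x‖ ^ 2 ≤ J := by
        refine le_of_mul_le_mul_left ?_ (show 0 < |x| by linarith)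
        linarith
      nlinarith [sq_nonneg ‖Q x‖]
  set M := max B √J
  have hM0 : 0 ≤ M := (norm_nonneg _).trans (hQreal 0)
  set N := M * Real.exp (σ + 1)
  have hMN : M ≤ N := le_mul_of_one_le_right hM0 (Real.one_le_exp (by linarith))
  -- Cauchy's estimate on unit circles, which lie in the strip `|Im z| ≤ 1` where Phragmén–Lindelöf
  -- bounds `Q` by `N`.
  have hderiv (x : ℝ) : ‖deriv Q x‖ ≤ N := by
    have := norm_deriv_le_of_forall_mem_sphere_norm_le (f := Q) (c := (x : ℂ)) (C := N)
      one_pos hQd.diffContOnCl fun z hz => ?_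
    · simpa using this
    · refine (hQtype.norm_le_exp_abs_im hQd (lt_add_one σ) hQreal z).trans ?_
      have him : |z.im| ≤ 1 := by
        have h := abs_im_le_norm (z - x)
        rw [mem_sphere_iff_norm.1 hz] at h
        simpa using h
      have : (σ + 1) * |z.im| ≤ σ + 1 := mul_le_of_le_one_right (by linarith) him
      exact mul_le_mul_of_nonneg_left (Real.exp_le_exp.2 this) hM0
  refine ⟨N, fun x => ?_⟩
  rw [hfQ]
  refine (norm_add_le _ _).trans ?_
  rw [norm_mul, norm_real, Real.norm_eq_abs, mul_add, mul_one, mul_comm N]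
  gcongr
  · exact (hQreal x).trans hMN
  · exact hderiv x

/-- A bounded entire regulariser: `s 0 = 1`, `|s x| ≤ min 1 (2 / |x|)` on the real line. -/
theorem _root_.exists_regulariser : ∃ s : ℂ → ℂ, Differentiable ℂ s ∧ HasExpTypeAtMost s 1 ∧
    s 0 = 1 ∧ (∀ x : ℝ, ‖s x‖ ≤ 1) ∧ ∀ x : ℝ, |x| * ‖s x‖ ≤ 2 := by
  have hd : Differentiable ℂ (_root_.dslope cexp 0) := differentiableOn_univ.1
    ((Complex.differentiableOn_dslope Filter.univ_mem).2 differentiable_exp.differentiableOn)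
  have hmul (x : ℝ) : |x| * ‖_root_.dslope cexp 0 (I * x)‖ = ‖cexp (I * x) - 1‖ := by
    have := sub_smul_dslope cexp 0 (I * x)
    rw [sub_zero, smul_eq_mul, Complex.exp_zero] at this
    rw [← this, norm_mul, norm_mul, norm_I, one_mul, norm_real, Real.norm_eq_abs]
  refine ⟨fun z => _root_.dslope cexp 0 (I * z), by fun_prop, ?_, by simp, fun x => ?_, fun x => ?_⟩
  · simpa using (cexp.dslope differentiable_exp zero_le_one).comp_mul I
  · rcases eq_or_ne x 0 with rfl | hx
    · simp
    · refine le_of_mul_le_mul_left ?_ (abs_pos.2 hx)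
      rw [hmul, mul_one]
      simpa using Real.norm_exp_I_mul_ofReal_sub_one_le (x := x)
  · rw [hmul]
    refine (norm_sub_le _ _).trans_eq ?_
    rw [norm_exp_I_mul_ofReal, norm_one]
    norm_num

theorem norm_add_mul_sq_le (hf : HasExpTypeAtMost f σ) (hd : Differentiable ℂ f)
    (hσ0 : 0 ≤ σ) (hL : MemLp (fun x : ℝ => f x) 2) {T : ℝ} (hσ : σ ≤ 2 * Real.pi * T)
    (a c : ℝ) :
    ‖f 0 + c * f a‖ ^ 2 ≤ (∫ ξ in -T..T, (1 + c ^ 2 + 2 * c * Real.cos (2 * Real.pi * a * ξ))) *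
      ∫ x : ℝ, ‖f x‖ ^ 2 := by
  obtain ⟨C, hC⟩ := hf.exists_norm_le_of_memLp hd hσ0 hL
  have hC0 : 0 ≤ C := by simpa using (norm_nonneg _).trans (hC 0)
  obtain ⟨s, hsd, hstype, hs0, hs1, hs2⟩ := exists_regulariser
  have hT : 0 ≤ T := by
    by_contra! h
    nlinarith [Real.pi_pos]
  set W : ℝ → ℝ := fun T => ∫ ξ in -T..T, (1 + c ^ 2 + 2 * c * Real.cos (2 * Real.pi * a * ξ))
    with hW
  have hWcont : Continuous W := by
    have hi : Continuous fun ξ : ℝ => 1 + c ^ 2 + 2 * c * Real.cos (2 * Real.pi * a * ξ) := by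
      fun_prop
    have h1 := intervalIntegral.continuous_primitive (μ := volume)
      (fun a b => hi.intervalIntegrable a b) 0
    have h2 : W = fun T => (∫ ξ in 0..T, (1 + c ^ 2 + 2 * c * Real.cos (2 * Real.pi * a * ξ))) -
        ∫ ξ in 0..(-T), (1 + c ^ 2 + 2 * c * Real.cos (2 * Real.pi * a * ξ)) := by
      ext T
      rw [intervalIntegral.integral_interval_sub_left (hi.intervalIntegrable _ _)
        (hi.intervalIntegrable _ _)]
    rw [h2]
    exact h1.sub (h1.comp continuous_neg)
  have hJ0 : 0 ≤ ∫ x : ℝ, ‖f x‖ ^ 2 := integral_nonneg fun t => by positivity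
  -- Three factors of order `1/|x|` turn linear growth into quadratic decay. They raise the type by
  -- `3ε`, within the `2πε` allowed by `T + ε`.
  have key (ε : ℝ) (hε : 0 < ε) : ‖f 0 * s (ε * (0 : ℝ)) ^ 3 + c * (f a * s (ε * a) ^ 3)‖ ^ 2 ≤
      W (T + ε) * ∫ x : ℝ, ‖f x‖ ^ 2 := by
    have hst : HasExpTypeAtMost (fun z => s (ε * z)) ε := by
      simpa [abs_of_pos hε] using hstype.comp_mul ε
    have htype : HasExpTypeAtMost (fun z => f z * s (ε * z) ^ 3) (σ + (ε + (ε + ε))) := by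
      convert hf.mul (hst.mul (hst.mul hst)) using 2
      ring
    have hle (x : ℝ) : ‖f x * s (ε * x) ^ 3‖ ≤ ‖f x‖ := by
      rw [norm_mul, norm_pow]
      refine mul_le_of_le_one_right (norm_nonneg _) (pow_le_one₀ (norm_nonneg _) ?_)
      simpa using hs1 (ε * x)
    have hdec (x : ℝ) : ‖f x * s (ε * x) ^ 3‖ * (1 + x ^ 2) ≤ C * (1 + 2 / ε) ^ 3 := by
      have h1 : ‖s (ε * x)‖ ≤ 1 := by simpa using hs1 (ε * x)
      have h2 : |x| * ‖s (ε * x)‖ ≤ 2 / ε := by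
        have := hs2 (ε * x)
        rw [abs_mul, abs_of_pos hε, ofReal_mul] at this
        rw [le_div_iff₀ hε]
        linarith
      have h3 : (1 + |x|) * ‖s (ε * x)‖ ≤ 1 + 2 / ε := by linarith
      calc ‖f x * s (ε * x) ^ 3‖ * (1 + x ^ 2)
          ≤ (C * (1 + |x|) * ‖s (ε * x)‖ ^ 3) * (1 + |x|) ^ 2 := by
            rw [norm_mul, norm_pow]
            gcongr
            · exact hC x
            · rw [← sq_abs]
              nlinarith [abs_nonneg x]
        _ = C * ((1 + |x|) * ‖s (ε * x)‖) ^ 3 := by ring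
        _ ≤ _ := by gcongr
    have h := htype.norm_add_mul_sq_le_of_decay (by fun_prop) hdec (T := T + ε) (by linarith)
      (by nlinarith [Real.pi_gt_three]) a c
    have hWnn : 0 ≤ W (T + ε) := by
      refine intervalIntegral.integral_nonneg (by linarith) fun ξ _ => ?_
      nlinarith [Real.sin_sq_add_cos_sq (2 * Real.pi * a * ξ),
        sq_nonneg (c + Real.cos (2 * Real.pi * a * ξ)), sq_nonneg (Real.sin (2 * Real.pi * a * ξ))]
    have hmono : ∫ x : ℝ, ‖f x * s (ε * x) ^ 3‖ ^ 2 ≤ ∫ x : ℝ, ‖f x‖ ^ 2 := by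
      refine integral_mono_of_nonneg (.of_forall fun x => by positivity)
        (hL.integrable_norm_pow two_ne_zero) (.of_forall fun x => ?_)
      have := hle x
      dsimp only
      gcongr
    simp only [ofReal_zero] at h ⊢
    exact h.trans (mul_le_mul_of_nonneg_left hmono hWnn)
  have hscont (b : ℝ) : Continuous fun ε : ℝ => s (ε * b) :=
    hsd.continuous.comp (by fun_prop)
  have hlim1 : Tendsto (fun ε : ℝ => ‖f 0 * s (ε * (0 : ℝ)) ^ 3 + c * (f a * s (ε * a) ^ 3)‖ ^ 2)
      (𝓝[>] 0) (𝓝 (‖f 0 + c * f a‖ ^ 2)) := by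
    have hc : Continuous fun ε : ℝ =>
        ‖f 0 * s (ε * (0 : ℝ)) ^ 3 + c * (f a * s (ε * a) ^ 3)‖ ^ 2 := by
      exact ((continuous_const.mul ((hscont 0).pow 3)).add
        (continuous_const.mul (continuous_const.mul ((hscont a).pow 3)))).norm.pow 2
    have := (hc.tendsto 0).mono_left (nhdsWithin_le_nhds (s := Set.Ioi 0))
    simpa [hs0] using this
  have hlim2 : Tendsto (fun ε : ℝ => W (T + ε) * ∫ x : ℝ, ‖f x‖ ^ 2) (𝓝[>] 0)
      (𝓝 (W T * ∫ x : ℝ, ‖f x‖ ^ 2)) := by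
    have hc : Continuous fun ε : ℝ => W (T + ε) * ∫ x : ℝ, ‖f x‖ ^ 2 := by fun_prop
    have := (hc.tendsto 0).mono_left (nhdsWithin_le_nhds (s := Set.Ioi 0))
    simpa using this
  exact le_of_tendsto_of_tendsto hlim1 hlim2 (eventually_mem_nhdsWithin.mono key)

end HasExpTypeAtMost

/-! ### The constant for `p = 4` -/

theorem integral_one_add_sq_add_cos {b : ℝ} (hb : b ≠ 0) (c T : ℝ) :
    ∫ ξ in -T..T, (1 + c ^ 2 + 2 * c * Real.cos (b * ξ)) =
      2 * T * (1 + c ^ 2) + 4 * c * (Real.sin (b * T) / b) := by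
  rw [intervalIntegral.integral_add (by simp)
    (Continuous.intervalIntegrable (by fun_prop) _ _), intervalIntegral.integral_const_mul,
    intervalIntegral.integral_comp_mul_left _ hb, integral_cos]
  simp only [intervalIntegral.integral_const, smul_eq_mul, mul_neg, Real.sin_neg]
  field_simp
  ring

theorem PaleyWiener.norm_zero_pow_four_le {f : ℂ → ℂ} (hf : f ∈ PaleyWiener 4) :
    ‖f 0‖ ^ 4 ≤ (2 - 1 / 12) * ∫ x : ℝ, ‖f x‖ ^ 4 := by
  obtain ⟨hd, htype, hL⟩ := hf
  rw [show ENNReal.ofReal 4 = 4 by norm_num] at hL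
  set g : ℂ → ℂ := fun z => f z * star (f (star z)) with hg
  have hgd : Differentiable ℂ g := hd.mul fun z => by
    have h := (hd (star z)).star_star
    rwa [star_star] at h
  have hgtype : HasExpTypeAtMost g (2 * Real.pi) := by
    rw [two_mul]
    exact htype.mul htype.star_comp_star
  have hgx (x : ℝ) : g x = ((‖f x‖ ^ 2 : ℝ) : ℂ) := by
    simp [hg, Complex.mul_conj, Complex.normSq_eq_norm_sq]
  have hgnorm (x : ℝ) : ‖g x‖ = ‖f x‖ ^ 2 := by
    rw [hgx, Complex.norm_real, Real.norm_of_nonneg (by positivity)]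
  have hgcont : Continuous fun x : ℝ => g x := hgd.continuous.comp Complex.continuous_ofReal
  have hgL : MemLp (fun x : ℝ => g x) 2 := by
    rw [memLp_two_iff_integrable_sq_norm hgcont.aestronglyMeasurable]
    have := hL.integrable_norm_pow (p := 4) (by norm_num)
    refine this.congr (.of_forall fun x => ?_)
    simp only [hgnorm]
    ring
  -- At `a = 3/4` the sine is `-1`, and the constant `2(1 + c²) - 8c/(3π)` is smallest at `c =
  -- 2/(3π) ≈ 0.212`; `c = 1/5` is close enough.
  have h := hgtype.norm_add_mul_sq_le hgd (by positivity) hgL (T := 1) (by simp) (3 / 4) (1 / 5)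
  have hJ : ∫ x : ℝ, ‖g x‖ ^ 2 = ∫ x : ℝ, ‖f x‖ ^ 4 := by
    simp only [hgnorm]
    congr 1 with x
    ring
  have hJ0 : 0 ≤ ∫ x : ℝ, ‖f x‖ ^ 4 := integral_nonneg fun x => by positivity
  rw [hJ, integral_one_add_sq_add_cos (by positivity)] at h
  have hsin : Real.sin (2 * Real.pi * (3 / 4) * 1) = -1 := by
    rw [show 2 * Real.pi * (3 / 4) * 1 = Real.pi / 2 + Real.pi by ring, Real.sin_add_pi,
      Real.sin_pi_div_two]
  rw [hsin] at h
  have hconst : 2 * 1 * (1 + (1 / 5 : ℝ) ^ 2) + 4 * (1 / 5) * (-1 / (2 * Real.pi * (3 / 4))) ≤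
      2 - 1 / 12 := by
    have : (1 / 3.15 : ℝ) ≤ 1 / Real.pi :=
      one_div_le_one_div_of_le Real.pi_pos Real.pi_lt_d2.le
    rw [show (-1 : ℝ) / (2 * Real.pi * (3 / 4)) = -(2 / 3) * (1 / Real.pi) by
      field_simp
      norm_num]
    norm_num at this ⊢
    linarith
  have hlow : ‖f 0‖ ^ 2 ≤ ‖g 0 + ((1 / 5 : ℝ) : ℂ) * g ((3 / 4 : ℝ) : ℂ)‖ := by
    have h0 : g 0 = ((‖f 0‖ ^ 2 : ℝ) : ℂ) := by simpa using hgx 0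
    rw [h0, hgx, ← Complex.ofReal_mul, ← Complex.ofReal_add, Complex.norm_real,
      Real.norm_of_nonneg (by positivity)]
    have : 0 ≤ ‖f ((3 / 4 : ℝ) : ℂ)‖ ^ 2 := by positivity
    linarith
  calc ‖f 0‖ ^ 4 = (‖f 0‖ ^ 2) ^ 2 := by ring
    _ ≤ ‖g 0 + ((1 / 5 : ℝ) : ℂ) * g ((3 / 4 : ℝ) : ℂ)‖ ^ 2 := by gcongr
    _ ≤ _ := h
    _ ≤ _ := by gcongr

/-! ### Existence of the smallest constant -/

theorem PaleyWiener.exists_four_ne_zero : ∃ f ∈ PaleyWiener 4, f 0 ≠ 0 := by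
  obtain ⟨s, hd, htype, hs0, hs1, hs2⟩ := exists_regulariser
  refine ⟨s, ⟨hd, htype.mono (by linarith [Real.pi_gt_three]), ?_⟩, by simp [hs0]⟩
  have hcont : Continuous fun x : ℝ => s x := hd.continuous.comp Complex.continuous_ofReal
  rw [show ENNReal.ofReal 4 = 4 by norm_num,
    ← integrable_norm_rpow_iff hcont.aestronglyMeasurable (by norm_num) (by norm_num)]
  simp only [ENNReal.toReal_ofNat, Real.rpow_ofNat]
  -- `5 = 1 + 4`: the bounds `|s| ≤ 1` and `x²|s|² ≤ 4` give `|s|⁴(1 + x²) ≤ 5`.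
  refine (integrable_inv_one_add_sq.const_mul 5).mono'
    (hcont.norm.pow 4).aestronglyMeasurable (.of_forall fun x => ?_)
  have h1 := hs1 x
  have h2 : x ^ 2 * ‖s x‖ ^ 2 ≤ 4 := by
    rw [← sq_abs, ← mul_pow]
    nlinarith [hs2 x, mul_nonneg (abs_nonneg x) (norm_nonneg (s x))]
  have h3 : ‖s x‖ ^ 2 ≤ 1 := pow_le_one₀ (norm_nonneg _) h1
  rw [Real.norm_of_nonneg (by positivity), ← div_eq_mul_inv, le_div_iff₀ (by positivity)]
  nlinarith [sq_nonneg ‖s x‖]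

theorem two_sub_mem_pointEvalBounds : (2 - 1 / 12 : ℝ) ∈ pointEvalBounds 4 := by
  refine ⟨by norm_num, fun f hf => ?_⟩
  exact_mod_cast PaleyWiener.norm_zero_pow_four_le hf

/-- The admissible constants have a least element as soon as there is an admissible constant and
point evaluation at the origin does not vanish identically. -/
theorem isLeast_pointEvalConst {p : ℝ} (hne : (pointEvalBounds p).Nonempty)
    (hp : ∃ f ∈ PaleyWiener p, f 0 ≠ 0) : IsLeast (pointEvalBounds p) (pointEvalConst p) := by
  have hbdd : BddBelow (pointEvalBounds p) := ⟨0, fun C hC => hC.1.le⟩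
  have hint (f : ℂ → ℂ) : 0 ≤ ∫ x : ℝ, ‖f (x : ℂ)‖ ^ p := integral_nonneg fun x => by positivity
  have hle : ∀ f ∈ PaleyWiener p, ‖f 0‖ ^ p ≤ pointEvalConst p * ∫ x : ℝ, ‖f (x : ℂ)‖ ^ p := by
    intro f hf
    -- If the integral vanishes, the value of the constant is irrelevant and any admissible `C`
    -- forces `f 0` to satisfy the bound.
    rcases (hint f).eq_or_lt with h | h
    · obtain ⟨C, hC⟩ := hne
      simpa [← h] using hC.2 f hf
    · rw [← div_le_iff₀ h]
      exact le_csInf hne fun C hC => (div_le_iff₀ h).2 (hC.2 f hf)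
  refine ⟨⟨?_, hle⟩, fun C hC => csInf_le hbdd hC⟩
  obtain ⟨f, hf, hf0⟩ := hp
  have h : 0 < ‖f 0‖ ^ p := Real.rpow_pos_of_pos (norm_pos_iff.2 hf0) p
  exact pos_of_mul_pos_left (h.trans_le (hle f hf)) (hint f)

theorem theorem2p2 :
    IsLeast (pointEvalBounds 4) (pointEvalConst 4) ∧ pointEvalConst 4 ≤ 2 - 1 / 12 :=
  have h := isLeast_pointEvalConst ⟨_, two_sub_mem_pointEvalBounds⟩ PaleyWiener.exists_four_ne_zero
  ⟨h, h.2 two_sub_mem_pointEvalBounds⟩
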